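/- Let $E$ be a Euclidean space (a finite-dimensional real inner product space, e.g. $\mathbb{R}^n$ or a matrix space with the Frobenius norm), and let $M\subset E$ be a compact smooth embedded submanifold with the induced Riemannian metric, second fundamental form $\Pi$, tangent spaces $T_XM$ and exponential map $\operatorname{Exp}$. Let $\kappa_g>0$ be a constant such that $\|\Pi_X(\eta,\eta)\|\le\kappa_g\|\eta\|^2$ for all $X\in M$ and $\eta\in T_XM$, and put $D=\frac{2-\sqrt2}{\kappa_g}$. Let $N\ge 1$, let $X_1,\dots,X_N\in M$, and suppose that their Euclidean average $\bar X=\frac1N\sum_{i=1}^N X_i$ satisfies $d(\bar X,M)=\inf_{Y\in M}\|Y-\bar X\|<\frac{1}{2\kappa_g}$. Let $\hat X$ be any induced arithmetic mean of the points, i.e. $\hat X\in\arg\min_{Y\in M}\sum_{i=1}^N\|Y-X_i\|^2$, and let $\Omega=\operatorname{Exp}_{\hat X}\bigl(B(0_{\hat X},D)\bigr)\subseteq M$, where $B(0_{\hat X},D)=\{\eta\in T_{\hat X}M:\|\eta\|\le D\}$. Then $\hat X$ is the unique orthogonal projection of $\bar X$ to $M$ restricted to $\Omega$, that is, $$\arg\min_{Y\in\Omega}\|Y-\bar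 X\|=\{\hat X\}.$$ -/

import Mathlib

open Set
open scoped ContDiff Topology

section Submanifolds

variable {E : Type*} [NormedAddCommGroup E] [InnerProductSpace ℝ E] [FiniteDimensional ℝ E]

/-- `M` is a smooth embedded submanifold of dimension `d` of the Euclidean space `E`: around each
of its points there is a smooth diffeomorphism between open subsets of `E` that carries `M` to a
`d`-dimensional linear subspace. -/
def IsEmbeddedSubmanifold (d : ℕ) (M : Set E) : Prop :=
  ∀ x ∈ M, ∃ (φ : OpenPartialHomeomorph E E) (K : Submodule ℝ E),
    x ∈ φ.source ∧ Module.finrank ℝ K = d ∧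
    ContDiffOn ℝ ∞ φ φ.source ∧ ContDiffOn ℝ ∞ φ.symm φ.target ∧
    ∀ y ∈ φ.source, y ∈ M ↔ φ y ∈ K

/-- `γ` restricted to `I` is a smooth curve in `M`. -/
def IsSmoothCurveOn (M : Set E) (I : Set ℝ) (γ : ℝ → E) : Prop :=
  ContDiffOn ℝ ∞ γ I ∧ ∀ t ∈ I, γ t ∈ M

/-- The set of velocities `γ'(0)` of smooth curves `γ` in `M` with `γ(0) = x`. -/
def velocities (M : Set E) (x : E) : Set E :=
  {v | ∃ ε > 0, ∃ γ : ℝ → E, IsSmoothCurveOn M (Ioo (-ε) ε) γ ∧ γ 0 = x ∧ deriv γ 0 = v}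

/-- The tangent space `T_x M`. For an embedded submanifold the velocities already form a linear
subspace, so that the span adds nothing: see `mem_tangentSpaceAt_iff`. -/
noncomputable def tangentSpaceAt (M : Set E) (x : E) : Submodule ℝ E :=
  Submodule.span ℝ (velocities M x)

/-- The normal space `N_x M`, the orthogonal complement of `T_x M` in `E`. -/
noncomputable def normalSpaceAt (M : Set E) (x : E) : Submodule ℝ E :=
  (tangentSpaceAt M x)ᗮ

/-- The Levi-Civita covariant derivative at time `t`, along the curve `γ` in `M`, of the tangent
vector field `V`: the orthogonal projection to `T_{γ(t)} M` of the Euclidean derivative `V'(t)`. -/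
noncomputable def covariantDerivAlong (M : Set E) (γ V : ℝ → E) (t : ℝ) : E :=
  (tangentSpaceAt M (γ t)).starProjection (deriv V t)

/-- `γ` is a geodesic of `M` on the (open) interval `I`: its covariant acceleration vanishes. -/
def IsGeodesicOn (M : Set E) (I : Set ℝ) (γ : ℝ → E) : Prop :=
  IsSmoothCurveOn M I γ ∧ ∀ t ∈ I, covariantDerivAlong M γ (deriv γ) t = 0

/-- The graph of the exponential map: `y = Exp_x(η)`, that is, `y = γ(1)` for the geodesic `γ`
with `γ(0) = x` and `γ'(0) = η`, which is defined on an open interval that contains `[0, 1]`. -/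
def IsExp (M : Set E) (x η y : E) : Prop :=
  ∃ (a b : ℝ) (γ : ℝ → E), a < 0 ∧ 1 < b ∧ IsGeodesicOn M (Ioo a b) γ ∧
    γ 0 = x ∧ deriv γ 0 = η ∧ γ 1 = y

/-- The image `Exp_x(B(0_x, r))` of the ball of radius `r` around the origin of `T_x M`. -/
def expBall (M : Set E) (x : E) (r : ℝ) : Set E :=
  {y | ∃ η ∈ tangentSpaceAt M x, ‖η‖ ≤ r ∧ IsExp M x η y}

/-- `p` is the normal component at `0` of the Euclidean derivative `V'(0)` of a smooth vector field
`V` tangent to `M` along a smooth curve `γ` in `M`, with `γ(0) = x`, `γ'(0) = η` and `V(0) = ζ`.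
By the Gauss formula `∇_{γ'} V = D_{γ'} V + Π(γ', V)` this means `p = Π_x(η, ζ)`. -/
def IsSecondFundamentalForm (M : Set E) (x η ζ p : E) : Prop :=
  ∃ ε > 0, ∃ γ V : ℝ → E, IsSmoothCurveOn M (Ioo (-ε) ε) γ ∧ γ 0 = x ∧ deriv γ 0 = η ∧
    ContDiffOn ℝ ∞ V (Ioo (-ε) ε) ∧ (∀ t ∈ Ioo (-ε) ε, V t ∈ tangentSpaceAt M (γ t)) ∧ V 0 = ζ ∧
    p = (normalSpaceAt M x).starProjection (deriv V 0)

open Classical in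
/-- The second fundamental form `Π_x(η, ζ)` of `M`, for `η, ζ ∈ T_x M`. It depends neither on the
curve nor on the vector field used to compute it: see `secondFundamentalForm_eq`. -/
noncomputable def secondFundamentalForm (M : Set E) (x η ζ : E) : E :=
  if h : ∃ p, IsSecondFundamentalForm M x η ζ p then h.choose else 0

/-- The geodesic curvature of `M` is bounded by `κ`. -/
def GeodesicCurvatureBound (M : Set E) (κ : ℝ) : Prop :=
  ∀ x ∈ M, ∀ η ∈ tangentSpaceAt M x, ‖secondFundamentalForm M x η η‖ ≤ κ * ‖η‖ ^ 2

/-- The Euclidean average of `X_1, …, X_N`. -/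
noncomputable def euclideanAverage {N : ℕ} (X : Fin N → E) : E :=
  (N : ℝ)⁻¹ • ∑ i, X i

/-- The set of induced arithmetic means: the minimizers over `M` of `Y ↦ ∑ᵢ ‖Y - X_i‖²`. -/
def inducedArithmeticMeans (M : Set E) {N : ℕ} (X : Fin N → E) : Set E :=
  {Y | Y ∈ M ∧ ∀ Z ∈ M, ∑ i, ‖Y - X i‖ ^ 2 ≤ ∑ i, ‖Z - X i‖ ^ 2}

/-- The set of orthogonal projections of `x` to `M` restricted to `Ω`: the minimizers over `M ∩ Ω`
of the distance to `x`. -/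
def restrictedProjections (M Ω : Set E) (x : E) : Set E :=
  {Y | Y ∈ M ∩ Ω ∧ ∀ Z ∈ M ∩ Ω, ‖Y - x‖ ≤ ‖Z - x‖}

/-! Well-definedness of the tangent space and of the second fundamental form. -/

/-- A local defining function of `M` around `x`. -/
theorem exists_defining_function {d : ℕ} {M : Set E} (hM : IsEmbeddedSubmanifold d M)
    {x : E} (hx : x ∈ M) :
    ∃ (U : Set E) (F : E → E), IsOpen U ∧ x ∈ U ∧ ContDiffOn ℝ ∞ F U ∧
      (∀ y ∈ U ∩ M, F y = 0) ∧
      ∀ y ∈ U ∩ M, ∀ v, fderiv ℝ F y v = 0 ↔ v ∈ velocities M y := by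
  obtain ⟨φ, K, hxs, -, hφ, hψ, hMK⟩ := hM x hx
  have hF : ContDiffOn ℝ ∞ (fun y => Kᗮ.starProjection (φ y)) φ.source :=
    Kᗮ.starProjection.contDiff.comp_contDiffOn hφ
  have hF0 : ∀ y ∈ φ.source ∩ M, Kᗮ.starProjection (φ y) = 0 := by
    intro y hy
    rw [Submodule.starProjection_apply_eq_zero_iff, Submodule.orthogonal_orthogonal]
    exact (hMK y hy.1).1 hy.2
  refine ⟨φ.source, fun y => Kᗮ.starProjection (φ y), φ.open_source, hxs, hF, hF0, ?_⟩
  intro y hy v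
  have hnhds : φ.source ∈ 𝓝 y := φ.open_source.mem_nhds hy.1
  have hφd : DifferentiableAt ℝ φ y := (hφ.contDiffAt hnhds).differentiableAt (by simp)
  have hfd : fderiv ℝ (fun y => Kᗮ.starProjection (φ y)) y v
      = Kᗮ.starProjection (fderiv ℝ φ y v) := by
    have := (Kᗮ.starProjection.hasFDerivAt.comp y hφd.hasFDerivAt).fderiv
    have h2 : fderiv ℝ (fun y => Kᗮ.starProjection (φ y)) y
      = Kᗮ.starProjection.comp (fderiv ℝ φ y) := this
    rw [h2]; rfl
  constructor
  · intro h
    rw [hfd, Submodule.starProjection_apply_eq_zero_iff, Submodule.orthogonal_orthogonal] at h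
    set u := fderiv ℝ φ y v with hu
    have hcont : Continuous fun t : ℝ => φ y + t • u := by fun_prop
    have hopen : IsOpen ((fun t : ℝ => φ y + t • u) ⁻¹' φ.target) :=
      φ.open_target.preimage hcont
    have h0 : (0 : ℝ) ∈ (fun t : ℝ => φ y + t • u) ⁻¹' φ.target := by
      simpa using φ.map_source hy.1
    obtain ⟨ε, hε, hball⟩ := Metric.isOpen_iff.1 hopen 0 h0
    rw [Real.ball_eq_Ioo, zero_sub, zero_add] at hball
    refine ⟨ε, hε, fun t => φ.symm (φ y + t • u), ⟨?_, ?_⟩, ?_, ?_⟩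
    · exact hψ.comp (by fun_prop) hball
    · intro t ht
      rw [hMK _ (φ.map_target (hball ht)), φ.right_inv (hball ht)]
      exact K.add_mem ((hMK y hy.1).1 hy.2) (K.smul_mem _ h)
    · simp [φ.left_inv hy.1]
    · have hψd : DifferentiableAt ℝ φ.symm (φ y) :=
        (hψ.contDiffAt (φ.open_target.mem_nhds (φ.map_source hy.1))).differentiableAt (by simp)
      have hid : HasFDerivAt (φ.symm ∘ φ) (ContinuousLinearMap.id ℝ E) y := by
        refine (hasFDerivAt_id y).congr_of_eventuallyEq ?_
        filter_upwards [hnhds] with z hz using φ.left_inv hz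
      have hv : fderiv ℝ φ.symm (φ y) u = v := by
        have := (hψd.hasFDerivAt.comp y hφd.hasFDerivAt).unique hid
        simpa using congrArg (fun L : E →L[ℝ] E => L v) this
      have hl : HasDerivAt (fun t : ℝ => φ y + t • u) u 0 := by
        simpa using ((hasDerivAt_id (0 : ℝ)).smul_const u).const_add (φ y)
      have hψd' : HasFDerivAt φ.symm (fderiv ℝ φ.symm (φ y)) (φ y + (0 : ℝ) • u) := by
        simpa using hψd.hasFDerivAt
      rw [← hv]
      exact (hψd'.comp_hasDerivAt (0 : ℝ) hl).deriv
  · rintro ⟨ε, hε, γ, ⟨hγ, hγM⟩, hγ0, hγv⟩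
    have hI : Ioo (-ε) ε ∈ 𝓝 (0 : ℝ) := Ioo_mem_nhds (by linarith) hε
    have hγd : DifferentiableAt ℝ γ 0 := (hγ.contDiffAt hI).differentiableAt (by simp)
    have hFd : DifferentiableAt ℝ (fun y => Kᗮ.starProjection (φ y)) (γ 0) := by
      rw [hγ0]; exact (hF.contDiffAt hnhds).differentiableAt (by simp)
    have h1 := hFd.hasFDerivAt.comp_hasDerivAt (0 : ℝ) hγd.hasDerivAt
    have h2 : HasDerivAt ((fun y => Kᗮ.starProjection (φ y)) ∘ γ) 0 0 := by
      refine (hasDerivAt_const (0 : ℝ) (0 : E)).congr_of_eventuallyEq ?_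
      have hs : ∀ᶠ t in 𝓝 (0 : ℝ), γ t ∈ φ.source :=
        hγd.continuousAt.eventually (by rw [hγ0]; exact hnhds)
      filter_upwards [hs, hI] with t ht htI using hF0 _ ⟨ht, hγM t htI⟩
    rw [← hγ0, ← hγv]
    exact h1.unique h2

/-- The velocities of curves through a point of an embedded submanifold form a linear subspace. -/
theorem mem_tangentSpaceAt_iff {d : ℕ} {M : Set E} (hM : IsEmbeddedSubmanifold d M)
    {x : E} (hx : x ∈ M) (v : E) : v ∈ tangentSpaceAt M x ↔ v ∈ velocities M x := by
  obtain ⟨U, F, -, hxU, -, -, hker⟩ := exists_defining_function hM hx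
  refine ⟨fun h => ?_, fun h => Submodule.subset_span h⟩
  have hle : tangentSpaceAt M x ≤ LinearMap.ker (fderiv ℝ F x).toLinearMap :=
    Submodule.span_le.2 fun w hw => (hker x ⟨hxU, hx⟩ w).2 hw
  exact (hker x ⟨hxU, hx⟩ v).1 (hle h)

/-- The value of the second fundamental form does not depend on the curve and the vector field. -/
theorem IsSecondFundamentalForm.unique {d : ℕ} {M : Set E} (hM : IsEmbeddedSubmanifold d M)
    {x η ζ p q : E} (hp : IsSecondFundamentalForm M x η ζ p)
    (hq : IsSecondFundamentalForm M x η ζ q) : p = q := by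
  have hx : x ∈ M := by
    obtain ⟨ε, hε, γ, V, ⟨-, hγM⟩, hγ0, -⟩ := hp
    exact hγ0 ▸ hγM 0 ⟨by linarith, hε⟩
  obtain ⟨U, F, hU, hxU, hF, -, hker⟩ := exists_defining_function hM hx
  have hFx : ContDiffAt ℝ ∞ F x := hF.contDiffAt (hU.mem_nhds hxU)
  have hF2 : DifferentiableAt ℝ (fderiv ℝ F) x :=
    (hFx.fderiv_right (m := 1) (by norm_cast)).differentiableAt (by simp)
  have key : ∀ r, IsSecondFundamentalForm M x η ζ r → ∃ w,
      r = (normalSpaceAt M x).starProjection w ∧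
      fderiv ℝ (fderiv ℝ F) x η ζ + fderiv ℝ F x w = 0 := by
    rintro r ⟨ε, hε, γ, V, ⟨hγ, hγM⟩, hγ0, hγv, hV, hVT, hV0, hr⟩
    have hI : Ioo (-ε) ε ∈ 𝓝 (0 : ℝ) := Ioo_mem_nhds (by linarith) hε
    have hγd : DifferentiableAt ℝ γ 0 := (hγ.contDiffAt hI).differentiableAt (by simp)
    have hVd : DifferentiableAt ℝ V 0 := (hV.contDiffAt hI).differentiableAt (by simp)
    refine ⟨deriv V 0, hr, ?_⟩
    have hF2' : HasFDerivAt (fderiv ℝ F) (fderiv ℝ (fderiv ℝ F) x) (γ 0) := by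
      rw [hγ0]; exact hF2.hasFDerivAt
    have h1 := (hF2'.comp_hasDerivAt (0 : ℝ) hγd.hasDerivAt).clm_apply hVd.hasDerivAt
    have h2 : HasDerivAt (fun t => (fderiv ℝ F ∘ γ) t (V t)) 0 0 := by
      refine (hasDerivAt_const (0 : ℝ) (0 : E)).congr_of_eventuallyEq ?_
      have hs : ∀ᶠ t in 𝓝 (0 : ℝ), γ t ∈ U :=
        hγd.continuousAt.eventually (by rw [hγ0]; exact hU.mem_nhds hxU)
      filter_upwards [hs, hI] with t ht htI
      exact (hker _ ⟨ht, hγM t htI⟩ _).2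
        ((mem_tangentSpaceAt_iff hM (hγM t htI) _).1 (hVT t htI))
    have := h1.unique h2
    simpa [hγ0, hγv, hV0] using this
  obtain ⟨w, rfl, hw⟩ := key p hp
  obtain ⟨w', rfl, hw'⟩ := key q hq
  have hsub : fderiv ℝ F x (w - w') = 0 := by
    rw [map_sub, sub_eq_zero]
    exact add_left_cancel (hw.trans hw'.symm)
  rw [← sub_eq_zero, ← map_sub, Submodule.starProjection_apply_eq_zero_iff, normalSpaceAt,
    Submodule.orthogonal_orthogonal]
  exact Submodule.subset_span ((hker x ⟨hxU, hx⟩ _).1 hsub)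

/-- The second fundamental form may be computed with any curve and any vector field. -/
theorem secondFundamentalForm_eq {d : ℕ} {M : Set E} (hM : IsEmbeddedSubmanifold d M)
    {x η ζ p : E} (hp : IsSecondFundamentalForm M x η ζ p) :
    secondFundamentalForm M x η ζ = p := by
  have h : ∃ p, IsSecondFundamentalForm M x η ζ p := ⟨p, hp⟩
  rw [secondFundamentalForm, dif_pos h]
  exact h.choose_spec.unique hM hp

end Submanifolds

/-! The sum of squared distances to the points is `N` times the squared distance to their average
`c`, plus a constant, so an induced mean is a point of `M` globally nearest to `c`. Uniqueness is a
convexity argument along geodesics. For a geodesic `γ` of speed `s` from the mean, put `f t = ‖γ t -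
c‖ ^ 2`. Minimality gives `f' 0 = 0`, and `f'' = 2 * (s ^ 2 + ⟪γ - c, γ''⟫)`. Since `γ''` is the
second fundamental form of `γ'`, its norm is at most `κ * s ^ 2`, while `‖γ t - c‖ ≤ s * t + 1 / (2
* κ)`. Hence `f'' ≥ s ^ 2 * (1 - 2 * κ * s * t)`, and integrating twice gives `f 1 - f 0 ≥ s ^ 2 *
(1 / 2 - κ * s / 3)` (`IsGeodesicOn.norm_sub_sq_add_le`). This is positive for `0 < κ * s < 3 / 2`,
and the ball only allows `κ * s ≤ 2 - √2 < 1`. -/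

/-! ### Induced means as nearest points to the average -/

section Average

variable {E : Type*} [NormedAddCommGroup E] [InnerProductSpace ℝ E]

/-- The sum of squared distances to finitely many points splits into the squared distance to
their average and the total variance. -/
theorem sum_norm_sub_sq_eq {N : ℕ} (hN : 0 < N) (X : Fin N → E) (Y : E) :
    ∑ i, ‖Y - X i‖ ^ 2
      = N * ‖Y - euclideanAverage X‖ ^ 2 + ∑ i, ‖euclideanAverage X - X i‖ ^ 2 := by
  set a := euclideanAverage X with ha
  have hN' : (N : ℝ) ≠ 0 := by exact_mod_cast hN.ne'
  -- Deviations from the average cancel, which kills the cross terms of the expanded squares.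
  have hsum : ∑ i, (a - X i) = 0 := by
    rw [Finset.sum_sub_distrib, Finset.sum_const, Finset.card_univ, Fintype.card_fin,
      ← Nat.cast_smul_eq_nsmul ℝ, ha, euclideanAverage, smul_inv_smul₀ hN', sub_self]
  have hterm : ∀ i, ‖Y - X i‖ ^ 2
      = ‖Y - a‖ ^ 2 + 2 * inner ℝ (Y - a) (a - X i) + ‖a - X i‖ ^ 2 := by
    intro i
    rw [← norm_add_sq_real, sub_add_sub_cancel]
  simp_rw [hterm]
  rw [Finset.sum_add_distrib, Finset.sum_add_distrib, ← Finset.mul_sum, ← inner_sum, hsum]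
  simp

/-- The induced arithmetic means are the points of `M` closest to the Euclidean average. -/
theorem norm_sub_le_of_mem_inducedArithmeticMeans {M : Set E} {N : ℕ} (hN : 0 < N)
    {X : Fin N → E} {Y Z : E} (hY : Y ∈ inducedArithmeticMeans M X) (hZ : Z ∈ M) :
    ‖Y - euclideanAverage X‖ ≤ ‖Z - euclideanAverage X‖ := by
  have h := hY.2 Z hZ
  rw [sum_norm_sub_sq_eq hN, sum_norm_sub_sq_eq hN X Z, add_le_add_iff_right] at h
  exact le_of_sq_le_sq (le_of_mul_le_mul_left h (by exact_mod_cast hN)) (norm_nonneg _)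

end Average

/-! ### Geodesics and the distance to a fixed point -/

section Curves

variable {E : Type*} [NormedAddCommGroup E] [InnerProductSpace ℝ E] {M : Set E} {a b t : ℝ}
  {γ : ℝ → E}

/-- A function with nonnegative derivative on an interval does not decrease. -/
theorem le_of_hasDerivAt_nonneg {u u' : ℝ → ℝ} {p q : ℝ} (hpq : p ≤ q)
    (hu : ∀ t ∈ Icc p q, HasDerivAt u (u' t) t) (hu' : ∀ t ∈ Icc p q, 0 ≤ u' t) :
    u p ≤ u q := by
  refine monotoneOn_of_deriv_nonneg (convex_Icc p q)
    (fun t ht => (hu t ht).continuousAt.continuousWithinAt) ?_ ?_ (left_mem_Icc.2 hpq)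
    (right_mem_Icc.2 hpq) hpq <;> rw [interior_Icc] <;> intro t ht
  · exact (hu t (Ioo_subset_Icc_self ht)).differentiableAt.differentiableWithinAt
  · rw [(hu t (Ioo_subset_Icc_self ht)).deriv]
    exact hu' t (Ioo_subset_Icc_self ht)

theorem IsSmoothCurveOn.hasDerivAt (hγ : IsSmoothCurveOn M (Ioo a b) γ) (ht : t ∈ Ioo a b) :
    HasDerivAt γ (deriv γ t) t :=
  ((hγ.1.contDiffAt (isOpen_Ioo.mem_nhds ht)).differentiableAt (by simp)).hasDerivAt

theorem IsSmoothCurveOn.contDiffOn_deriv (hγ : IsSmoothCurveOn M (Ioo a b) γ) :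
    ContDiffOn ℝ ∞ (deriv γ) (Ioo a b) :=
  hγ.1.deriv_of_isOpen isOpen_Ioo (by simp)

theorem IsSmoothCurveOn.hasDerivAt_deriv (hγ : IsSmoothCurveOn M (Ioo a b) γ)
    (ht : t ∈ Ioo a b) : HasDerivAt (deriv γ) (deriv (deriv γ) t) t :=
  ((hγ.contDiffOn_deriv.contDiffAt (isOpen_Ioo.mem_nhds ht)).differentiableAt
    (by simp)).hasDerivAt

/-- A symmetric interval around an interior point of an interval, translated to the origin. -/
theorem exists_mapsTo_Ioo_add (ht : t ∈ Ioo a b) :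
    ∃ ε > 0, MapsTo (fun r => r + t) (Ioo (-ε) ε) (Ioo a b) := by
  refine ⟨min (t - a) (b - t), lt_min (sub_pos.2 ht.1) (sub_pos.2 ht.2), fun r hr => ?_⟩
  have h1 := min_le_left (t - a) (b - t)
  have h2 := min_le_right (t - a) (b - t)
  exact ⟨by linarith [hr.1], by linarith [hr.2]⟩

/-- Velocities and the second fundamental form are defined at time `0` of a symmetric interval;
translating time reaches every other `t`. -/
theorem IsSmoothCurveOn.comp_add {ε : ℝ} (hγ : IsSmoothCurveOn M (Ioo a b) γ)
    (hε : MapsTo (fun r => r + t) (Ioo (-ε) ε) (Ioo a b)) :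
    IsSmoothCurveOn M (Ioo (-ε) ε) (fun r => γ (r + t)) :=
  ⟨hγ.1.comp (by fun_prop) hε, fun _ hr => hγ.2 _ (hε hr)⟩

theorem IsSmoothCurveOn.deriv_mem_tangentSpaceAt (hγ : IsSmoothCurveOn M (Ioo a b) γ)
    (ht : t ∈ Ioo a b) : deriv γ t ∈ tangentSpaceAt M (γ t) := by
  obtain ⟨ε, hε, hmaps⟩ := exists_mapsTo_Ioo_add ht
  refine Submodule.subset_span ⟨ε, hε, fun r => γ (r + t), hγ.comp_add hmaps, by simp, ?_⟩
  rw [deriv_comp_add_const, zero_add]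

theorem isGeodesicOn_const {x : E} [FiniteDimensional ℝ E] (hx : x ∈ M) (I : Set ℝ) :
    IsGeodesicOn M I (fun _ => x) :=
  ⟨⟨contDiffOn_const, fun _ _ => hx⟩, fun t _ => by simp [covariantDerivAlong]⟩

variable [FiniteDimensional ℝ E]

/-- Both the constant speed and the curvature bound on the acceleration rest on this orthogonality
to the velocity space. -/
theorem IsGeodesicOn.deriv_deriv_mem_normalSpaceAt (hγ : IsGeodesicOn M (Ioo a b) γ)
    (ht : t ∈ Ioo a b) : deriv (deriv γ) t ∈ normalSpaceAt M (γ t) := by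
  have h := hγ.2 t ht
  rwa [covariantDerivAlong, Submodule.starProjection_apply_eq_zero_iff] at h

/-- The Euclidean acceleration of a geodesic is the second fundamental form of its velocity. -/
theorem IsGeodesicOn.secondFundamentalForm_deriv {d : ℕ} (hM : IsEmbeddedSubmanifold d M)
    (hγ : IsGeodesicOn M (Ioo a b) γ) (ht : t ∈ Ioo a b) :
    secondFundamentalForm M (γ t) (deriv γ t) (deriv γ t) = deriv (deriv γ) t := by
  obtain ⟨ε, hε, hmaps⟩ := exists_mapsTo_Ioo_add ht
  -- The vector field is the velocity itself; its derivative is already normal, so the projection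
  -- fixes it.
  refine secondFundamentalForm_eq hM ⟨ε, hε, fun r => γ (r + t), fun r => deriv γ (r + t),
    hγ.1.comp_add hmaps, by simp, ?_, hγ.1.contDiffOn_deriv.comp (by fun_prop) hmaps,
    fun r hr => hγ.1.deriv_mem_tangentSpaceAt (hmaps hr), by simp, ?_⟩
  · rw [deriv_comp_add_const, zero_add]
  · rw [deriv_comp_add_const, zero_add, eq_comm, Submodule.starProjection_eq_self_iff]
    exact hγ.deriv_deriv_mem_normalSpaceAt ht

/-- Geodesics have constant speed. -/
theorem IsGeodesicOn.norm_deriv_eq (hγ : IsGeodesicOn M (Ioo a b) γ) {r : ℝ}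
    (hr : r ∈ Ioo a b) (ht : t ∈ Ioo a b) : ‖deriv γ t‖ = ‖deriv γ r‖ := by
  have hder : ∀ s ∈ Ioo a b, HasDerivAt (fun s => ‖deriv γ s‖ ^ 2) 0 s := by
    intro s hs
    have h := (hγ.1.hasDerivAt_deriv hs).norm_sq
    rwa [Submodule.inner_right_of_mem_orthogonal (hγ.1.deriv_mem_tangentSpaceAt hs)
      (hγ.deriv_deriv_mem_normalSpaceAt hs), mul_zero] at h
  have h : ‖deriv γ t‖ ^ 2 = ‖deriv γ r‖ ^ 2 :=
    isOpen_Ioo.is_const_of_deriv_eq_zero isPreconnected_Ioo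
      (fun s hs => (hder s hs).differentiableAt.differentiableWithinAt)
      (fun s hs => (hder s hs).deriv) ht hr
  exact (sq_eq_sq₀ (norm_nonneg _) (norm_nonneg _)).1 h

/-- A geodesic moves away from the starting point by at most its length. -/
theorem IsGeodesicOn.norm_sub_le (hγ : IsGeodesicOn M (Ioo a b) γ) (ha : a < 0) (h0 : 0 ≤ t)
    (ht : t < b) : ‖γ t - γ 0‖ ≤ ‖deriv γ 0‖ * t := by
  have hsub : Icc 0 t ⊆ Ioo a b := fun s hs => ⟨ha.trans_le hs.1, hs.2.trans_lt ht⟩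
  have h := (convex_Icc 0 t).norm_image_sub_le_of_norm_hasDerivWithin_le
    (fun s hs => (hγ.1.hasDerivAt (hsub hs)).hasDerivWithinAt)
    (fun s hs => (hγ.norm_deriv_eq (hsub (left_mem_Icc.2 h0)) (hsub hs)).le)
    (left_mem_Icc.2 h0) (right_mem_Icc.2 h0)
  rwa [sub_zero, Real.norm_of_nonneg h0] at h

/-- A geodesic that starts at a point of `M` closest to `c`, at distance less than half the
curvature radius, moves away from `c` at a quantitative rate. -/
theorem IsGeodesicOn.norm_sub_sq_add_le {d : ℕ} (hM : IsEmbeddedSubmanifold d M) {κ : ℝ}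
    (hκ : 0 < κ) (hcurv : GeodesicCurvatureBound M κ) (hγ : IsGeodesicOn M (Ioo a b) γ)
    (ha : a < 0) (hb : 1 < b) {c : E} (hmin : ∀ Z ∈ M, ‖γ 0 - c‖ ≤ ‖Z - c‖)
    (hc : ‖γ 0 - c‖ ≤ 1 / (2 * κ)) :
    ‖γ 0 - c‖ ^ 2 + ‖deriv γ 0‖ ^ 2 * (1 / 2 - κ * ‖deriv γ 0‖ / 3) ≤ ‖γ 1 - c‖ ^ 2 := by
  set s := ‖deriv γ 0‖ with hs
  have h0 : (0 : ℝ) ∈ Ioo a b := ⟨ha, by linarith⟩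
  have hsub : ∀ t ∈ Icc (0 : ℝ) 1, t ∈ Ioo a b := fun t ht =>
    ⟨ha.trans_le ht.1, ht.2.trans_lt hb⟩
  have hspeed : ∀ t ∈ Ioo a b, ‖deriv γ t‖ = s := fun t ht => hγ.norm_deriv_eq h0 ht
  have hf : ∀ t ∈ Ioo a b,
      HasDerivAt (fun t => ‖γ t - c‖ ^ 2) (2 * inner ℝ (γ t - c) (deriv γ t)) t := fun t ht =>
    ((hγ.1.hasDerivAt ht).sub_const c).norm_sq
  have hf' : ∀ t ∈ Ioo a b, HasDerivAt (fun t => 2 * inner ℝ (γ t - c) (deriv γ t))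
      (2 * (inner ℝ (γ t - c) (deriv (deriv γ) t) + s ^ 2)) t := by
    intro t ht
    have h := (((hγ.1.hasDerivAt ht).sub_const c).inner ℝ (hγ.1.hasDerivAt_deriv ht)).const_mul
      (2 : ℝ)
    rwa [real_inner_self_eq_norm_sq, hspeed t ht] at h
  -- Time `0` is interior to the domain of `γ`, so minimality over `M` makes it a critical point.
  have hcrit : 2 * inner ℝ (γ 0 - c) (deriv γ 0) = 0 := by
    refine IsLocalMin.hasDerivAt_eq_zero ?_ (hf 0 h0)
    filter_upwards [isOpen_Ioo.mem_nhds h0] with t ht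
    gcongr
    exact hmin _ (hγ.1.2 t ht)
  have hacc : ∀ t ∈ Icc (0 : ℝ) 1, s ^ 2 * (1 - 2 * (κ * s) * t)
      ≤ 2 * (inner ℝ (γ t - c) (deriv (deriv γ) t) + s ^ 2) := by
    intro t ht
    have h1 : ‖deriv (deriv γ) t‖ ≤ κ * s ^ 2 := by
      rw [← hspeed t (hsub t ht), ← hγ.secondFundamentalForm_deriv hM (hsub t ht)]
      exact hcurv _ (hγ.1.2 t (hsub t ht)) _ (hγ.1.deriv_mem_tangentSpaceAt (hsub t ht))
    have h2 : ‖γ t - c‖ ≤ s * t + 1 / (2 * κ) := by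
      rw [← sub_add_sub_cancel (γ t) (γ 0) c]
      exact (norm_add_le _ _).trans
        (add_le_add (hγ.norm_sub_le ha ht.1 (ht.2.trans_lt hb)) hc)
    have h3 : ‖γ t - c‖ * ‖deriv (deriv γ) t‖ ≤ (s * t + 1 / (2 * κ)) * (κ * s ^ 2) :=
      mul_le_mul h2 h1 (norm_nonneg _) ((norm_nonneg _).trans h2)
    have h4 := (abs_le.1 (abs_real_inner_le_norm (γ t - c) (deriv (deriv γ) t))).1
    -- The radius `1 / (2 * κ)` contributes exactly `1 / 2`, so half of the convexity term `s ^ 2`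
    -- survives at `t = 0`.
    have h5 : (s * t + 1 / (2 * κ)) * (κ * s ^ 2) = s ^ 2 * (κ * s * t + 1 / 2) := by
      field_simp
    linarith
  -- First integration: the difference vanishes at `0` by `hcrit` and is nondecreasing by `hacc`.
  have hvel : ∀ t ∈ Icc (0 : ℝ) 1,
      0 ≤ 2 * inner ℝ (γ t - c) (deriv γ t) - s ^ 2 * (t - κ * s * t ^ 2) := by
    intro t ht
    have hp : ∀ r, HasDerivAt (fun r : ℝ => s ^ 2 * (r - κ * s * r ^ 2))
        (s ^ 2 * (1 - 2 * (κ * s) * r)) r := by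
      intro r
      refine (((hasDerivAt_id r).sub
        ((hasDerivAt_pow 2 r).const_mul (κ * s))).const_mul (s ^ 2)).congr_deriv ?_
      push_cast
      ring
    have h := le_of_hasDerivAt_nonneg ht.1
      (fun r hr => (hf' r (hsub r ⟨hr.1, hr.2.trans ht.2⟩)).sub (hp r))
      (fun r hr => sub_nonneg.2 (hacc r ⟨hr.1, hr.2.trans ht.2⟩))
    simpa [hcrit] using h
  -- Second integration, against a primitive of the lower bound in `hvel`.
  have hq : ∀ r, HasDerivAt (fun r : ℝ => s ^ 2 * (r ^ 2 / 2 - κ * s * (r ^ 3 / 3)))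
      (s ^ 2 * (r - κ * s * r ^ 2)) r := by
    intro r
    refine ((((hasDerivAt_pow 2 r).div_const 2).sub
      (((hasDerivAt_pow 3 r).div_const 3).const_mul (κ * s))).const_mul (s ^ 2)).congr_deriv ?_
    push_cast
    ring
  have h := le_of_hasDerivAt_nonneg zero_le_one
    (fun r hr => (hf r (hsub r hr)).sub (hq r)) hvel
  norm_num at h
  linarith

end Curves

/-! ### Uniqueness of the restricted projection -/

theorem mainTheorem8 {E : Type*} [NormedAddCommGroup E] [InnerProductSpace ℝ E]
    [FiniteDimensional ℝ E] (d : ℕ) (M : Set E) (hM : IsEmbeddedSubmanifold d M)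
    (hMc : IsCompact M) (κ : ℝ) (hκ : 0 < κ) (hcurv : GeodesicCurvatureBound M κ)
    (N : ℕ) (hN : 0 < N) (X : Fin N → E) (hX : ∀ i, X i ∈ M)
    (hdist : Metric.infDist (euclideanAverage X) M < 1 / (2 * κ))
    (Xhat : E) (hXhat : Xhat ∈ inducedArithmeticMeans M X) :
    restrictedProjections M (expBall M Xhat ((2 - Real.sqrt 2) / κ)) (euclideanAverage X)
      = {Xhat} := by
  have hmin : ∀ Z ∈ M, ‖Xhat - euclideanAverage X‖ ≤ ‖Z - euclideanAverage X‖ := fun Z hZ =>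
    norm_sub_le_of_mem_inducedArithmeticMeans hN hXhat hZ
  have hc : ‖Xhat - euclideanAverage X‖ ≤ 1 / (2 * κ) := by
    refine le_trans ((Metric.le_infDist ⟨Xhat, hXhat.1⟩).2 fun {Z} hZ => ?_) hdist.le
    rw [dist_comm, dist_eq_norm]
    exact hmin Z hZ
  -- `1 < √2` keeps `κ` times the radius below `1`; `√2 ≤ 2` makes the radius nonnegative, so that
  -- the ball contains `0`.
  have h2 : (1 : ℝ) < Real.sqrt 2 := Real.lt_sqrt_of_sq_lt (by norm_num)
  have h2' : Real.sqrt 2 ≤ 2 := Real.sqrt_le_iff.2 (by norm_num)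
  have hmem : Xhat ∈ M ∩ expBall M Xhat ((2 - Real.sqrt 2) / κ) := by
    refine ⟨hXhat.1, 0, Submodule.zero_mem _, ?_, -1, 2, fun _ => Xhat, by norm_num,
      by norm_num, isGeodesicOn_const hXhat.1 _, rfl, by simp, rfl⟩
    rw [norm_zero]
    exact div_nonneg (sub_nonneg.2 h2') hκ.le
  refine Subset.antisymm ?_ (singleton_subset_iff.2 ⟨hmem, fun Z hZ => hmin Z hZ.1⟩)
  rintro Y ⟨⟨hYM, η, -, hη, a, b, γ, ha, hb, hγ, rfl, rfl, rfl⟩, hYmin⟩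
  have hY := hYmin _ hmem
  have hrate := hγ.norm_sub_sq_add_le hM hκ hcurv ha hb hmin hc
  have hle : ‖γ 1 - euclideanAverage X‖ ^ 2 ≤ ‖γ 0 - euclideanAverage X‖ ^ 2 := by gcongr
  rw [le_div_iff₀ hκ] at hη
  -- A positive speed would put `γ 1` strictly farther from the average than `γ 0`, against `hle`.
  have hs : ‖deriv γ 0‖ = 0 := by
    by_contra hne
    have hpos : 0 < ‖deriv γ 0‖ ^ 2 * (1 / 2 - κ * ‖deriv γ 0‖ / 3) :=
      mul_pos (by positivity) (by linarith)
    linarith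
  have h := hγ.norm_sub_le ha zero_le_one hb
  rw [hs, zero_mul, norm_le_zero_iff, sub_eq_zero] at h
  exact h
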